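/- Let $1\le k\le n$. Let $\mathbb{E}^{n,1}=\mathbb{R}^n\times\mathbb{R}$ carry the form $\langle x,y\rangle=\sum_{i=1}^n x_iy_i-x_{n+1}y_{n+1}$, let $H^n=\{\langle x,x\rangle=-1,\ x_{n+1}>0\}$ be the hyperboloid and $\mathbb{L}=\{\langle x,x\rangle=0,\ x_{n+1}>0\}$ the light cone, and let $\pi(x)=\frac{1}{x_{n+1}}(x_1,\dots,x_n)$ be the radial projection, which maps $H^n$ bijectively onto the open unit disc $D^n$ and $\mathbb{L}$ onto $\partial D^n=S^{n-1}_\infty$. Give $D^n$ the hyperbolic metric induced from $H^n$ via $\pi$ (Klein model), with distance $d$. Let $\Delta^k$ be the standard $k$-simplex. The straight $k$-simplex with vertices $v_0,\dots,v_k\in D^n$ is the map $\Delta^k\to D^n$, $(s_0,\dots,s_k)\mapsto \pi\bigl(\sum_i s_iu_i\bigr)$, where $u_i\in H^n$ and $\pi(u_i)=v_i$. A straight ideal $k$-simplex with vertices $v_0^*,\dots,v_k^*\in\partial D^n$ is a map $\Delta^k\to\overline{D^n}$ of the form $(s_0,\dots,s_k)\mapsto\pi\bigl(\sum_i s_iu_i\bigr)$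 for some $u_i\in\mathbb{L}$ with $\pi(u_i)=v_i^*$. The volume $\operatorname{vol}(\sigma)\in[0,\infty]$ of such a simplex $\sigma$ is its (unsigned) $k$-dimensional hyperbolic volume, that is, the integral over the interior of $\Delta^k$ of the Riemannian volume density of the metric pulled back by $\sigma$. Let $\{\sigma_t:\Delta^k\to D^n\mid t\ge 0\}$ be a family of straight $k$-simplices such that, for each $i$, the $i$-th vertex $v_{i,t}$ of $\sigma_t$ lies on a geodesic ray $l_i$ with end point $v_i^*\in\partial D^n$ and moves toward $v_i^*$ at unit speed, i.e. $d(v_{i,0},v_{i,t})=t$ for all $t\ge0$. If $v_0^*,\dots,v_k^*$ are pairwise distinct, then, as $t\to\infty$, the family $\{\sigma_t\}$ converges pointwise on $\Delta^k$ to a straight ideal $k$-simplex $\sigma_\infty:\Delta^k\to\overline{D^n}$ with vertices $v_0^*,\dots,v_k^*$. Furthermore, $$\lim_{t\to\infty}\operatorname{vol}(\sigma_t)=\operatorname{vol}(\sigma_\infty).$$ Here $\operatorname{vol}(\sigma_t)<\infty$ for all $t\ge 0$, and $\operatorname{vol}(\sigma_\infty)<\infty$ if $k\ge2$; for $k=1$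 the limit is taken in $[0,\infty]$. -/

import Mathlib

open Set Filter Topology MeasureTheory

noncomputable section

namespace HypSimplex

/-- Points of `ℝⁿ`, with the Euclidean norm. -/
abbrev Euc (n : ℕ) : Type := EuclideanSpace ℝ (Fin n)

/-- Minkowski space `𝔼^{n,1} = ℝⁿ × ℝ`; the last factor is the time coordinate `x_{n+1}`. -/
abbrev Mink (n : ℕ) : Type := Euc n × ℝ

/-- The Lorentzian inner product `x₁ y₁ + ⋯ + xₙ yₙ - x_{n+1} y_{n+1}`. -/
def lor {n : ℕ} (x y : Mink n) : ℝ := inner ℝ x.1 y.1 - x.2 * y.2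

/-- The hyperboloid model `Hⁿ`. -/
def hyperboloid (n : ℕ) : Set (Mink n) := {x | lor x x = -1 ∧ 0 < x.2}

/-- The (positive) light cone `𝕃`. -/
def lightCone (n : ℕ) : Set (Mink n) := {x | lor x x = 0 ∧ 0 < x.2}

/-- The open unit disc `Dⁿ`, the underlying set of the Klein model. -/
def disc (n : ℕ) : Set (Euc n) := Metric.ball 0 1

/-- The sphere at infinity `∂Dⁿ`. -/
def sphereInfty (n : ℕ) : Set (Euc n) := Metric.sphere 0 1

/-- The radial projection `π`, where `ℝⁿ × {1}` is identified with `ℝⁿ`. -/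
def proj {n : ℕ} (x : Mink n) : Euc n := (x.2)⁻¹ • x.1

/-- The inverse `π⁻¹ : Dⁿ → Hⁿ` of the radial projection (meaningful on `disc n`). -/
def lift {n : ℕ} (x : Euc n) : Mink n := (√(1 - ‖x‖ ^ 2))⁻¹ • (x, (1 : ℝ))

lemma lift_mem {n : ℕ} {x : Euc n} (hx : x ∈ disc n) : lift x ∈ hyperboloid n := by
  have h1 : ‖x‖ < 1 := by simpa [disc] using hx
  have h2 : 0 < 1 - ‖x‖ ^ 2 := by nlinarith [norm_nonneg x]
  have h3 : 0 < √(1 - ‖x‖ ^ 2) := Real.sqrt_pos.2 h2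
  have h4 : √(1 - ‖x‖ ^ 2) ^ 2 = 1 - ‖x‖ ^ 2 := Real.sq_sqrt h2.le
  refine ⟨?_, by simpa [lift] using h3⟩
  simp only [lor, lift, Prod.smul_mk, inner_smul_left, inner_smul_right,
    real_inner_self_eq_norm_sq, smul_eq_mul, mul_one, conj_trivial]
  field_simp
  linarith

lemma proj_lift {n : ℕ} {x : Euc n} (hx : x ∈ disc n) : proj (lift x) = x := by
  have h3 := (lift_mem hx).2
  simp only [lift, Prod.smul_mk, smul_eq_mul, mul_one] at h3
  simp only [proj, lift, Prod.smul_mk, smul_eq_mul, mul_one, smul_smul]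
  rw [inv_mul_cancel₀ h3.ne', one_smul]

/-- The Riemannian metric of the Klein model at `x ∈ Dⁿ`: the one induced from `Hⁿ` via `π`, that
is, the pull-back of the Lorentzian inner product under the differential of `π⁻¹`. -/
def kleinMetric {n : ℕ} (x v w : Euc n) : ℝ :=
  lor (fderiv ℝ (lift (n := n)) x v) (fderiv ℝ (lift (n := n)) x w)

/-- Hyperbolic distance on `Dⁿ`, determined by `cosh d(x, y) = -⟨π⁻¹ x, π⁻¹ y⟩`. -/
def hypDist {n : ℕ} (x y : Euc n) : ℝ := Real.arcosh (-lor (lift x) (lift y))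

/-- In the Klein model, the geodesic ray from `p ∈ Dⁿ` to the ideal point `ξ ∈ ∂Dⁿ` is the
half-open Euclidean segment from `p` (included) to `ξ` (excluded). -/
def geodesicRay {n : ℕ} (p ξ : Euc n) : Set (Euc n) := segment ℝ p ξ \ {ξ}

/-- The affine simplex `(t₀, …, t_k) ↦ ∑ tᵢ uᵢ` in Minkowski space. -/
def affineSimplex {n k : ℕ} (u : Fin (k + 1) → Mink n) (t : Fin (k + 1) → ℝ) : Mink n :=
  ∑ i, t i • u i

/-- The straight simplex with vertices `vᵢ ∈ Dⁿ` (a map on the standard simplex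
`stdSimplex ℝ (Fin (k + 1))`; values elsewhere are irrelevant). -/
def straightSimplex {n k : ℕ} (v : Fin (k + 1) → Euc n) (t : Fin (k + 1) → ℝ) : Euc n :=
  proj (affineSimplex (fun i => lift (v i)) t)

/-- `τ` is a straight ideal simplex with vertices `ξᵢ ∈ ∂Dⁿ`: on the standard simplex it is
`π ∘ σ`, where `σ` is the affine simplex of some points `uᵢ` of the light cone with
`π uᵢ = ξᵢ`. -/
def IsStraightIdealSimplex {n k : ℕ} (ξ : Fin (k + 1) → Euc n)
    (τ : (Fin (k + 1) → ℝ) → Euc n) : Prop :=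
  (∀ i, ξ i ∈ sphereInfty n) ∧
  ∃ u : Fin (k + 1) → Mink n, (∀ i, u i ∈ lightCone n ∧ proj (u i) = ξ i) ∧
    ∀ t ∈ stdSimplex ℝ (Fin (k + 1)), τ t = proj (affineSimplex u t)

/-- The interior of the standard `k`-simplex in the coordinates `(t₁, …, t_k)`. -/
def openCoordSimplex (k : ℕ) : Set (Fin k → ℝ) := {x | (∀ i, 0 < x i) ∧ ∑ i, x i < 1}

/-- The affine chart `(t₁, …, t_k) ↦ (1 - ∑ tᵢ, t₁, …, t_k)` of the standard simplex. -/
def baryChart {k : ℕ} (x : Fin k → ℝ) : Fin (k + 1) → ℝ := Fin.cons (1 - ∑ i, x i) x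

/-- The `k`-dimensional hyperbolic volume, in `[0, ∞]`, of a map `f` from the standard `k`-simplex
to the Klein model: the integral over the interior of the simplex (whose boundary is a null set) of
the Riemannian volume density `√ det (g (∂ᵢ f, ∂ⱼ f))` of the pulled back metric. -/
def simplexVol {n k : ℕ} (f : (Fin (k + 1) → ℝ) → Euc n) : ENNReal :=
  ∫⁻ x in openCoordSimplex k, ENNReal.ofReal (√ (Matrix.det (Matrix.of fun i j : Fin k =>
    kleinMetric (f (baryChart x))
      (fderiv ℝ (fun y => f (baryChart y)) x (Pi.single i 1))
      (fderiv ℝ (fun y => f (baryChart y)) x (Pi.single j 1)))))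

end HypSimplex

end

/-!
The volume of a straight simplex has a closed form. Span the simplex by vectors `w₀, …, w_k` of the
open or closed future cone and put `W(s) = ∑ sᵢ wᵢ`. Since `π⁻¹ ∘ π` is the normalization
`X ↦ X / √(-⟨X, X⟩)`, the Gram matrix of the pulled back metric is a rank one perturbation of the
Gram matrix of the edges `wᵢ - w₀`, and a Schur complement gives the volume density
`√(-G(w)) / (-⟨W(s), W(s)⟩) ^ ((k + 1) / 2)`, where the Gram determinant `G(w)` of
`w₀, w₁ - w₀, …, w_k - w₀` does not depend on `s` (`simplexVol_proj_affineSimplex`). The vectors `w`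
may be rescaled by a common factor without changing the simplex.

On a ray ending at `ξᵢ`, the lift of the point at distance `t`, divided by `cosh t`, converges to a
point `uᵢ` of the light cone above `ξᵢ` (`exists_tendsto_inv_cosh_smul_lift`). The factor is the same
for all `i`, so the simplices converge pointwise to the ideal simplex of the `uᵢ`, and so do the
densities.

As the `ξᵢ` are distinct, `-⟨uᵢ, uⱼ⟩ > 0` for `i ≠ j`, so for large `t` the quantity
`-⟨W(s), W(s)⟩` is at least a constant times `∑ sᵢ (1 - sᵢ)`, hence at least a constant times each
`sᵢ (1 - sᵢ)`. Distributing the exponent `(k + 1) / 2` over the `k` coordinates bounds the density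
by a constant times `∏ (sᵢ (1 - sᵢ)) ^ (-(k + 1) / (2 k))` (`density_le_prod_betaFactor`). For
`k ≥ 2` the exponent exceeds `-1`, the bound is a product of convergent Beta integrals, and
dominated convergence applies. For `k = 1` the ideal segment has infinite length and Fatou's lemma
shows that the lengths tend to infinity.
-/

noncomputable section

namespace HypSimplex

variable {n k : ℕ}

/-! ### The Lorentzian form -/

lemma lor_comm (x y : Mink n) : lor x y = lor y x := by
  simp only [lor, real_inner_comm, mul_comm]

lemma lor_add_left (x y z : Mink n) : lor (x + y) z = lor x z + lor y z := by
  simp only [lor, Prod.fst_add, Prod.snd_add, inner_add_left]; ring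

lemma lor_smul_left (c : ℝ) (x y : Mink n) : lor (c • x) y = c * lor x y := by
  simp only [lor, Prod.smul_fst, Prod.smul_snd, real_inner_smul_left, smul_eq_mul]; ring

lemma lor_add_right (x y z : Mink n) : lor x (y + z) = lor x y + lor x z := by
  simp only [lor_comm x, lor_add_left]

lemma lor_smul_right (c : ℝ) (x y : Mink n) : lor x (c • y) = c * lor x y := by
  simp only [lor_comm x, lor_smul_left]

lemma lor_sub_left (x y z : Mink n) : lor (x - y) z = lor x z - lor y z := by
  simp only [lor, Prod.fst_sub, Prod.snd_sub, inner_sub_left]; ring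

lemma lor_sub_right (x y z : Mink n) : lor x (y - z) = lor x y - lor x z := by
  simp only [lor_comm x, lor_sub_left]

lemma lor_sum_left {ι : Type*} (s : Finset ι) (f : ι → Mink n) (y : Mink n) :
    lor (∑ i ∈ s, f i) y = ∑ i ∈ s, lor (f i) y := by
  simp only [lor, Prod.fst_sum, Prod.snd_sum, sum_inner, Finset.sum_mul, Finset.sum_sub_distrib]

lemma lor_sum_right {ι : Type*} (s : Finset ι) (x : Mink n) (f : ι → Mink n) :
    lor x (∑ i ∈ s, f i) = ∑ i ∈ s, lor x (f i) := by
  simp only [lor_comm x, lor_sum_left]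

lemma continuous_lor : Continuous fun z : Mink n × Mink n => lor z.1 z.2 := by
  unfold lor; fun_prop

/-- The reverse Cauchy–Schwarz inequality on the hyperboloid. -/
lemma one_le_neg_lor {x y : Mink n} (hx : x ∈ hyperboloid n) (hy : y ∈ hyperboloid n) :
    1 ≤ -lor x y := by
  obtain ⟨hx1, hx2⟩ := hx
  obtain ⟨hy1, hy2⟩ := hy
  simp only [lor, real_inner_self_eq_norm_sq] at hx1 hy1 ⊢
  have h := real_inner_le_norm x.1 y.1
  have h1 : 1 + ‖x.1‖ * ‖y.1‖ ≤ x.2 * y.2 := by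
    apply le_of_sq_le_sq _ (by positivity)
    have : (x.2 * y.2) ^ 2 = (1 + ‖x.1‖ ^ 2) * (1 + ‖y.1‖ ^ 2) := by
      rw [show 1 + ‖x.1‖ ^ 2 = x.2 * x.2 by linarith, show 1 + ‖y.1‖ ^ 2 = y.2 * y.2 by linarith]
      ring
    rw [this]
    nlinarith [sq_nonneg (‖x.1‖ - ‖y.1‖)]
  linarith

/-- The point `(ξ, 1)` of the light cone above `ξ`. -/
def ideal (ξ : Euc n) : Mink n := (ξ, 1)

lemma lor_ideal_self {ξ : Euc n} (hξ : ξ ∈ sphereInfty n) : lor (ideal ξ) (ideal ξ) = 0 := by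
  have : ‖ξ‖ = 1 := by simpa [sphereInfty] using hξ
  simp [lor, ideal, this]

lemma lor_ideal_neg {ξ η : Euc n} (hξ : ξ ∈ sphereInfty n) (hη : η ∈ sphereInfty n)
    (hne : ξ ≠ η) : lor (ideal ξ) (ideal η) < 0 := by
  have h1 : ‖ξ‖ = 1 := by simpa [sphereInfty] using hξ
  have h2 : ‖η‖ = 1 := by simpa [sphereInfty] using hη
  have := (inner_lt_one_iff_real_of_norm_eq_one h1 h2).2 hne
  simp only [lor, ideal]; linarith

lemma lor_lift_ideal_neg {p ξ : Euc n} (hp : p ∈ disc n) (hξ : ξ ∈ sphereInfty n) :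
    lor (lift p) (ideal ξ) < 0 := by
  have h1 : ‖ξ‖ = 1 := by simpa [sphereInfty] using hξ
  have h2 : ‖p‖ < 1 := by simpa [disc] using hp
  have h3 := (lift_mem hp).2
  simp only [lift, Prod.smul_mk, smul_eq_mul, mul_one] at h3
  have h4 := real_inner_le_norm p ξ
  rw [lift, lor_smul_left]
  apply mul_neg_of_pos_of_neg h3
  simp only [lor, ideal]
  rw [h1] at h4
  linarith

lemma proj_smul {c : ℝ} (hc : c ≠ 0) (x : Mink n) : proj (c • x) = proj x := by
  simp only [proj, Prod.smul_fst, Prod.smul_snd, smul_eq_mul, smul_smul]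
  congr 1
  field_simp

lemma affineSimplex_smul (c : ℝ) (w : Fin (k + 1) → Mink n) (s : Fin (k + 1) → ℝ) :
    affineSimplex (fun i => c • w i) s = c • affineSimplex w s := by
  simp only [affineSimplex, Finset.smul_sum, smul_comm c]

lemma affineSimplex_snd_pos {w : Fin (k + 1) → Mink n} (hw : ∀ i, 0 < (w i).2)
    {s : Fin (k + 1) → ℝ} (hs : s ∈ stdSimplex ℝ (Fin (k + 1))) : 0 < (affineSimplex w s).2 := by
  obtain ⟨i, hi⟩ : ∃ i, 0 < s i := by
    by_contra! h
    have := Finset.sum_nonpos fun i (_ : i ∈ Finset.univ) => h i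
    rw [hs.2] at this
    linarith
  simp only [affineSimplex, Prod.snd_sum, Prod.smul_snd, smul_eq_mul]
  exact Finset.sum_pos' (fun j _ => mul_nonneg (hs.1 j) (hw j).le)
    ⟨i, Finset.mem_univ i, mul_pos hi (hw i)⟩

/-! ### Asymptotics of a point escaping along a geodesic ray -/

/-- `geodesicRay p ξ` is the projection of the cone of vectors `α π⁻¹(p) + β (ξ, 1)`. -/
lemma exists_lift_eq_of_mem_geodesicRay {p ξ v : Euc n} (hp : p ∈ disc n)
    (hξ : ξ ∈ sphereInfty n) (hv : v ∈ geodesicRay p ξ) :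
    v ∈ disc n ∧ ∃ α β : ℝ, 0 < α ∧ 0 ≤ β ∧ lift v = α • lift p + β • ideal ξ := by
  obtain ⟨⟨a, b, ha, hb, hab, rfl⟩, hne⟩ := hv
  have h1 : ‖ξ‖ = 1 := by simpa [sphereInfty] using hξ
  have h2 : ‖p‖ < 1 := by simpa [disc] using hp
  have ha0 : 0 < a := by
    refine lt_of_le_of_ne ha fun h => hne ?_
    subst h
    obtain rfl : b = 1 := by linarith
    simp
  have hd : a • p + b • ξ ∈ disc n := by
    simp only [disc, mem_ball_zero_iff]
    calc ‖a • p + b • ξ‖ ≤ ‖a • p‖ + ‖b • ξ‖ := norm_add_le _ _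
      _ = a * ‖p‖ + b := by rw [norm_smul, norm_smul, h1, Real.norm_of_nonneg ha,
          Real.norm_of_nonneg hb, mul_one]
      _ < 1 := by nlinarith
  have h3 := (lift_mem hp).2
  have h4 := (lift_mem hd).2
  simp only [lift, Prod.smul_mk, smul_eq_mul, mul_one] at h3 h4
  refine ⟨hd, (√(1 - ‖a • p + b • ξ‖ ^ 2))⁻¹ * a * √(1 - ‖p‖ ^ 2),
    (√(1 - ‖a • p + b • ξ‖ ^ 2))⁻¹ * b, ?_, by positivity, ?_⟩
  · have := inv_pos.1 h3
    positivity
  · have := (inv_pos.1 h3).ne'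
    simp only [lift, ideal]
    ext1
    · simp only [Prod.smul_mk, Prod.fst_add, smul_add, smul_smul]
      congr 2
      field_simp
    · simp only [Prod.smul_mk, Prod.snd_add, smul_eq_mul]
      field_simp
      rw [hab]

/-- Scaled by `1 / cosh t`, the lift of a point at distance `t` on a ray ending at `ξ` converges to
a point of the light cone above `ξ`. With `π⁻¹(v t) = α π⁻¹(p) + β (ξ, 1)`, the norm condition makes
`α` bounded, so `α / cosh t → 0`; the distance condition expresses `cosh t` as a linear function of
`(α, β)`, so `β / cosh t` converges. -/
lemma exists_tendsto_inv_cosh_smul_lift {p ξ : Euc n} (hp : p ∈ disc n) (hξ : ξ ∈ sphereInfty n)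
    {v : ℝ → Euc n} (hray : ∀ t, 0 ≤ t → v t ∈ geodesicRay p ξ)
    (hspeed : ∀ t, 0 ≤ t → hypDist (v 0) (v t) = t) :
    ∃ m : ℝ, 0 < m ∧
      Tendsto (fun t => (Real.cosh t)⁻¹ • lift (v t)) atTop (𝓝 (m • ideal ξ)) := by
  have key := fun t ht => exists_lift_eq_of_mem_geodesicRay hp hξ (hray t ht)
  obtain ⟨hq, a, b, ha, hb, hQ⟩ := key 0 le_rfl
  set c := -lor (lift p) (ideal ξ) with hc
  have hc0 : 0 < c := by have := lor_lift_ideal_neg hp hξ; linarith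
  have hX := lor_ideal_self hξ
  have hP := (lift_mem hp).1
  have hcosh : Tendsto Real.cosh atTop atTop := by
    refine tendsto_atTop_mono (fun t => ?_) (Real.tendsto_exp_atTop.atTop_mul_const
      (show (0 : ℝ) < 1 / 2 by norm_num))
    rw [Real.cosh_eq]
    linarith [Real.exp_pos (-t)]
  have hinv : Tendsto (fun t => (Real.cosh t)⁻¹) atTop (𝓝 0) := tendsto_inv_atTop_zero.comp hcosh
  have key2 : ∀ t, ∃ α β : ℝ, 0 ≤ t → (0 < α ∧ α ≤ 1 ∧
      Real.cosh t = a * α + (a * β + b * α) * c ∧ lift (v t) = α • lift p + β • ideal ξ) := by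
    intro t
    by_cases ht : 0 ≤ t
    swap
    · exact ⟨0, 0, fun h => (ht h).elim⟩
    obtain ⟨hd, α, β, hα, hβ, h⟩ := key t ht
    refine ⟨α, β, fun _ => ⟨hα, ?_, ?_, h⟩⟩
    · have h1 := (lift_mem hd).1
      rw [h] at h1
      simp only [lor_add_left, lor_add_right, lor_smul_left, lor_smul_right, hX, hP,
        lor_comm (ideal ξ) (lift p)] at h1
      have : α ^ 2 + 2 * (α * β * c) = 1 := by rw [hc]; linarith
      have h3 : 0 ≤ α * β * c := by positivity
      nlinarith
    · have h1 := hspeed t ht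
      rw [hypDist] at h1
      have h2 := Real.cosh_arcosh (one_le_neg_lor (lift_mem hq) (lift_mem hd))
      rw [h1] at h2
      rw [h2, h, hQ]
      simp only [lor_add_left, lor_add_right, lor_smul_left, lor_smul_right, hX, hP,
        lor_comm (ideal ξ) (lift p)]
      rw [hc]; ring
  choose α β hαβ using key2
  have hA : Tendsto (fun t => (Real.cosh t)⁻¹ * α t) atTop (𝓝 0) := by
    refine squeeze_zero' (g := fun t => (Real.cosh t)⁻¹) ?_ ?_ hinv
    all_goals
      filter_upwards [eventually_ge_atTop 0] with t ht
      have h0 := inv_pos.2 (Real.cosh_pos t)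
      have h1 := hαβ t ht
    · exact mul_nonneg h0.le h1.1.le
    · nlinarith
  have hB : Tendsto (fun t => (Real.cosh t)⁻¹ * β t) atTop (𝓝 (a * c)⁻¹) := by
    have : Tendsto (fun t => (1 - (a + b * c) * ((Real.cosh t)⁻¹ * α t)) * (a * c)⁻¹) atTop
        (𝓝 ((1 - (a + b * c) * 0) * (a * c)⁻¹)) :=
      ((hA.const_mul _).const_sub 1).mul_const _
    simp only [mul_zero, sub_zero, one_mul] at this
    refine this.congr' ?_
    filter_upwards [eventually_ge_atTop 0] with t ht
    have h0 := (Real.cosh_pos t).ne'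
    have h1 := (hαβ t ht).2.2.1
    field_simp
    linarith
  refine ⟨(a * c)⁻¹, by positivity, ?_⟩
  have := (hA.smul_const (lift p)).add (hB.smul_const (ideal ξ))
  rw [zero_smul, zero_add] at this
  refine this.congr' ?_
  filter_upwards [eventually_ge_atTop 0] with t ht
  rw [(hαβ t ht).2.2.2, smul_add, smul_smul, smul_smul]

/-! ### The volume density of a straight simplex -/

/-- The edge vector from the zeroth to the `(i + 1)`-st vertex. -/
def edge (w : Fin (k + 1) → Mink n) (i : Fin k) : Mink n := w i.succ - w 0

lemma affineSimplex_baryChart (w : Fin (k + 1) → Mink n) (x : Fin k → ℝ) :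
    affineSimplex w (baryChart x) = w 0 + ∑ i, x i • edge w i := by
  simp only [affineSimplex, baryChart, Fin.sum_univ_succ, Fin.cons_zero, Fin.cons_succ, edge,
    smul_sub, sub_smul, one_smul, Finset.sum_sub_distrib, Finset.sum_smul]
  abel

lemma affineSimplex_baryChart_add_smul_single (w : Fin (k + 1) → Mink n) (x : Fin k → ℝ)
    (i : Fin k) (t : ℝ) :
    affineSimplex w (baryChart (x + t • Pi.single i 1)) =
      affineSimplex w (baryChart x) + t • edge w i := by
  simp only [affineSimplex_baryChart, Pi.add_apply, Pi.smul_apply, smul_eq_mul, add_smul,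
    Finset.sum_add_distrib, Pi.single_apply, mul_ite, mul_one, mul_zero, ite_smul, zero_smul,
    Finset.sum_ite_eq', Finset.mem_univ, if_true, add_assoc]

/-- The Gram matrix, for the Lorentzian form, of `z` and the edge vectors of `w`. -/
def edgeGram (w : Fin (k + 1) → Mink n) (z : Mink n) : Matrix (Unit ⊕ Fin k) (Unit ⊕ Fin k) ℝ :=
  Matrix.of fun a b => lor (Sum.elim (fun _ => z) (edge w) a) (Sum.elim (fun _ => z) (edge w) b)

/-- Adding combinations of the edges to `z` is a unipotent change of basis, so it does not change
the Gram determinant. -/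
lemma det_edgeGram_add (w : Fin (k + 1) → Mink n) (z : Mink n) (x : Fin k → ℝ) :
    (edgeGram w (z + ∑ i, x i • edge w i)).det = (edgeGram w z).det := by
  set B : Matrix (Unit ⊕ Fin k) (Unit ⊕ Fin k) ℝ :=
    Matrix.fromBlocks 1 (Matrix.of fun _ j => x j) 0 1 with hB
  have hdet : B.det = 1 := by rw [hB, Matrix.det_fromBlocks_zero₂₁]; simp
  have : edgeGram w (z + ∑ i, x i • edge w i) = B * edgeGram w z * B.transpose := by
    ext a b
    rcases a with a | a <;> rcases b with b | b <;>
    simp [Matrix.mul_apply, hB, edgeGram, lor_add_left, lor_add_right, lor_sum_left, lor_sum_right,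
      lor_smul_left, lor_smul_right, Matrix.one_apply, mul_comm]
  rw [this, Matrix.det_mul, Matrix.det_mul, Matrix.det_transpose, hdet]
  ring

/-- The Schur complement of the entry `lor z z`. -/
lemma det_edgeGram_eq_mul (w : Fin (k + 1) → Mink n) {z : Mink n} (hz : lor z z ≠ 0) :
    (edgeGram w z).det = lor z z * (Matrix.of fun i j : Fin k =>
      lor (edge w i) (edge w j) - lor z (edge w i) * lor z (edge w j) / lor z z).det := by
  have h : edgeGram w z = Matrix.fromBlocks (Matrix.of fun _ _ => lor z z)
      (Matrix.of fun _ j => lor z (edge w j)) (Matrix.of fun i _ => lor (edge w i) z)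
      (Matrix.of fun i j => lor (edge w i) (edge w j)) := by
    ext a b
    rcases a with a | a <;> rcases b with b | b <;> rfl
  set A : Matrix Unit Unit ℝ := Matrix.of fun _ _ => lor z z with hA
  have hAd : A.det = lor z z := by simp [hA]
  have hu : IsUnit A.det := by rw [hAd]; exact hz.isUnit
  let _ : Invertible A := Matrix.invertibleOfIsUnitDet A hu
  have hinv : ⅟A = Matrix.of fun _ _ => (lor z z)⁻¹ := by
    refine invOf_eq_right_inv ?_
    ext a b
    simp [hA, Matrix.mul_apply, hz]
  rw [h, Matrix.det_fromBlocks₁₁, hAd, hinv]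
  congr 2
  ext i j
  simp [Matrix.mul_apply, lor_comm (edge w i) z]
  ring

lemma lift_proj {x : Mink n} (hx : 0 < x.2) (hneg : lor x x < 0) :
    lift (proj x) = (√(-lor x x))⁻¹ • x ∧ 0 < 1 - ‖proj x‖ ^ 2 := by
  have h1 : 1 - ‖proj x‖ ^ 2 = -lor x x / x.2 ^ 2 := by
    simp only [proj, norm_smul, lor, real_inner_self_eq_norm_sq, mul_pow, norm_inv, inv_pow,
      Real.norm_eq_abs, sq_abs]
    field_simp
    ring
  refine ⟨?_, by rw [h1]; exact div_pos (by linarith) (by positivity)⟩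
  rw [lift, h1, Real.sqrt_div' _ (by positivity), Real.sqrt_sq hx.le]
  have h2 : √(-lor x x) ≠ 0 := (Real.sqrt_pos.2 (by linarith)).ne'
  ext1
  · simp only [Prod.smul_mk, Prod.smul_fst, proj, smul_smul]
    congr 1
    field_simp
  · simp only [Prod.smul_mk, Prod.smul_snd, smul_eq_mul]
    field_simp

lemma hasDerivAt_normalize {X E : Mink n} (hneg : lor X X < 0) :
    HasDerivAt (fun t : ℝ => (√(-lor (X + t • E) (X + t • E)))⁻¹ • (X + t • E))
      ((√(-lor X X))⁻¹ • (E + (lor X E / -lor X X) • X)) 0 := by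
  have h0 : (0 : ℝ) < -lor X X := by linarith
  have h1 : HasDerivAt (fun t : ℝ => -lor (X + t • E) (X + t • E)) (-2 * lor X E) 0 := by
    have : (fun t : ℝ => -lor (X + t • E) (X + t • E)) =
        fun t => -lor X X - 2 * lor X E * t - lor E E * t ^ 2 := by
      ext t
      simp only [lor_add_left, lor_add_right, lor_smul_left, lor_smul_right, lor_comm E X]
      ring
    rw [this]
    have := (((hasDerivAt_id (0 : ℝ)).const_mul (2 * lor X E)).const_sub (-lor X X)).sub
      ((hasDerivAt_pow 2 (0 : ℝ)).const_mul (lor E E))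
    refine this.congr_deriv ?_
    simp
  have h2 : HasDerivAt (fun t : ℝ => X + t • E) E 0 := by
    simpa using ((hasDerivAt_id (0 : ℝ)).smul_const E).const_add X
  have h3 := (h1.sqrt (by simpa using h0.ne')).inv (by simpa using (Real.sqrt_pos.2 h0).ne')
  refine (h3.smul h2).congr_deriv ?_
  simp only [Pi.inv_apply, zero_smul, add_zero, smul_add, smul_smul]
  congr 2
  have h5 := (Real.sqrt_pos.2 h0).ne'
  have h6 := Real.sq_sqrt h0.le
  have h7 := hneg.ne
  field_simp
  rw [h6]
  field_simp

lemma differentiableAt_lift {x : Euc n} (hx : 0 < 1 - ‖x‖ ^ 2) :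
    DifferentiableAt ℝ (lift (n := n)) x := by
  unfold lift
  have h1 : DifferentiableAt ℝ (fun x : Euc n => 1 - ‖x‖ ^ 2) x :=
    ((contDiff_norm_sq ℝ (n := 1)).differentiable (by simp)).differentiableAt.const_sub 1
  exact ((h1.sqrt hx.ne').inv (Real.sqrt_pos.2 hx).ne').smul
    (differentiableAt_id.prodMk (differentiableAt_const _))

lemma kleinMetric_fderiv_proj (w : Fin (k + 1) → Mink n) (x : Fin k → ℝ) (i j : Fin k)
    (hpos : 0 < (affineSimplex w (baryChart x)).2)
    (hneg : lor (affineSimplex w (baryChart x)) (affineSimplex w (baryChart x)) < 0) :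
    kleinMetric (proj (affineSimplex w (baryChart x)))
      (fderiv ℝ (fun y => proj (affineSimplex w (baryChart y))) x (Pi.single i 1))
      (fderiv ℝ (fun y => proj (affineSimplex w (baryChart y))) x (Pi.single j 1)) =
    (-lor (affineSimplex w (baryChart x)) (affineSimplex w (baryChart x)))⁻¹ *
      (lor (edge w i) (edge w j) -
        lor (affineSimplex w (baryChart x)) (edge w i) *
        lor (affineSimplex w (baryChart x)) (edge w j) /
        lor (affineSimplex w (baryChart x)) (affineSimplex w (baryChart x))) := by
  have hW : Differentiable ℝ fun y : Fin k → ℝ => affineSimplex w (baryChart y) := by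
    simp only [affineSimplex_baryChart]
    fun_prop
  have hproj : DifferentiableAt ℝ (fun y => proj (affineSimplex w (baryChart y))) x :=
    ((hW x).snd.inv hpos.ne').smul (hW x).fst
  have hd : ∀ i, fderiv ℝ (lift (n := n)) (proj (affineSimplex w (baryChart x)))
      (fderiv ℝ (fun y => proj (affineSimplex w (baryChart y))) x (Pi.single i 1)) =
      (√(-lor (affineSimplex w (baryChart x)) (affineSimplex w (baryChart x))))⁻¹ • (edge w i +
        (lor (affineSimplex w (baryChart x)) (edge w i) /
          -lor (affineSimplex w (baryChart x)) (affineSimplex w (baryChart x))) •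
          affineSimplex w (baryChart x)) := by
    intro i
    have hl := (differentiableAt_lift (lift_proj hpos hneg).2).hasFDerivAt
    have hc := hl.comp x hproj.hasFDerivAt
    have hline : HasDerivAt (fun t : ℝ => x + t • (Pi.single i 1 : Fin k → ℝ)) (Pi.single i 1) 0 := by
      simpa using ((hasDerivAt_id (0 : ℝ)).smul_const (Pi.single i 1 : Fin k → ℝ)).const_add x
    have h1 := HasFDerivAt.comp_hasDerivAt_of_eq (0 : ℝ) hc hline (by simp)
    refine h1.unique ((hasDerivAt_normalize hneg).congr_of_eventuallyEq ?_)
    have hcont : Continuous fun t : ℝ => affineSimplex w (baryChart x) + t • edge w i := by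
      fun_prop
    have e1 : ∀ᶠ t in 𝓝 (0 : ℝ), 0 < (affineSimplex w (baryChart x) + t • edge w i).2 :=
      (continuous_snd.comp hcont).continuousAt.eventually (lt_mem_nhds (by simpa using hpos))
    have e2 : ∀ᶠ t in 𝓝 (0 : ℝ), lor (affineSimplex w (baryChart x) + t • edge w i)
        (affineSimplex w (baryChart x) + t • edge w i) < 0 :=
      (continuous_lor.comp (hcont.prodMk hcont)).continuousAt.eventually
        (gt_mem_nhds (by simpa using hneg))
    filter_upwards [e1, e2] with t h1 h2
    simp only [Function.comp, affineSimplex_baryChart_add_smul_single, (lift_proj h1 h2).1]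
  rw [kleinMetric, hd, hd]
  set X := affineSimplex w (baryChart x)
  have h0 : (0 : ℝ) < -lor X X := by linarith
  have h5 : (√(-lor X X))⁻¹ * (√(-lor X X))⁻¹ = (-lor X X)⁻¹ := by
    rw [← mul_inv, Real.mul_self_sqrt h0.le]
  simp only [lor_smul_left, lor_smul_right]
  rw [← mul_assoc, h5]
  congr 1
  simp only [lor_add_left, lor_add_right, lor_smul_left, lor_smul_right, lor_comm (edge w i) X]
  have := hneg.ne
  field_simp
  ring

/-- The volume density of the straight simplex spanned by the vectors `w`, which need not be
normalized. -/
def density (w : Fin (k + 1) → Mink n) (x : Fin k → ℝ) : ℝ :=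
  √(-(edgeGram w (w 0)).det /
    (-lor (affineSimplex w (baryChart x)) (affineSimplex w (baryChart x))) ^ (k + 1))

lemma baryChart_mem_stdSimplex {x : Fin k → ℝ} (hx : x ∈ openCoordSimplex k) :
    baryChart x ∈ stdSimplex ℝ (Fin (k + 1)) := by
  refine ⟨fun i => ?_, by simp [baryChart, Fin.sum_univ_succ]⟩
  refine Fin.cases ?_ (fun j => ?_) i
  · have := hx.2
    simp only [baryChart, Fin.cons_zero]; linarith
  · exact (hx.1 j).le

lemma measurableSet_openCoordSimplex : MeasurableSet (openCoordSimplex k) := by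
  refine IsOpen.measurableSet (IsOpen.inter ?_ ?_)
  · have : {x : Fin k → ℝ | ∀ i, 0 < x i} = ⋂ i, {x | 0 < x i} := by ext; simp
    change IsOpen {x : Fin k → ℝ | ∀ i, 0 < x i}
    rw [this]
    exact isOpen_iInter_of_finite fun i => isOpen_lt continuous_const (continuous_apply i)
  · change IsOpen {x : Fin k → ℝ | ∑ i, x i < 1}
    exact isOpen_lt (by fun_prop) continuous_const

lemma simplexVol_proj_affineSimplex {w : Fin (k + 1) → Mink n} (hw : ∀ i, 0 < (w i).2)
    (hneg : ∀ x ∈ openCoordSimplex k,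
      lor (affineSimplex w (baryChart x)) (affineSimplex w (baryChart x)) < 0) :
    simplexVol (fun s => proj (affineSimplex w s)) =
      ∫⁻ x in openCoordSimplex k, ENNReal.ofReal (density w x) := by
  refine setLIntegral_congr_fun measurableSet_openCoordSimplex fun x hx => ?_
  have hn := hneg x hx
  have hp := affineSimplex_snd_pos hw (baryChart_mem_stdSimplex hx)
  simp only [kleinMetric_fderiv_proj w x _ _ hp hn, density]
  congr 2
  have h1 := det_edgeGram_add w (w 0) x
  rw [← affineSimplex_baryChart, det_edgeGram_eq_mul w hn.ne] at h1
  rw [← h1]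
  set X := affineSimplex w (baryChart x)
  change Matrix.det ((-lor X X)⁻¹ • (Matrix.of fun i j : Fin k =>
      lor (edge w i) (edge w j) - lor X (edge w i) * lor X (edge w j) / lor X X)) = _
  rw [Matrix.det_smul, Fintype.card_fin]
  have hq : -lor X X ≠ 0 := by linarith
  rw [pow_succ, ← neg_mul, inv_pow]
  generalize -lor X X = q at hq ⊢
  field_simp

/-! ### Bounds for the volume density -/

lemma neg_lor_affineSimplex (w : Fin (k + 1) → Mink n) (s : Fin (k + 1) → ℝ) :
    -lor (affineSimplex w s) (affineSimplex w s) = ∑ i, ∑ j, s i * s j * -lor (w i) (w j) := by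
  simp only [affineSimplex, lor_sum_left, ← Finset.sum_neg_distrib]
  refine Finset.sum_congr rfl fun i _ => ?_
  simp only [lor_sum_right, lor_smul_left, lor_smul_right, ← Finset.sum_neg_distrib]
  exact Finset.sum_congr rfl fun j _ => by ring

lemma le_neg_lor_affineSimplex {w : Fin (k + 1) → Mink n} {c : ℝ}
    (h : ∀ i j, c ≤ -lor (w i) (w j)) {s : Fin (k + 1) → ℝ}
    (hs : s ∈ stdSimplex ℝ (Fin (k + 1))) :
    c ≤ -lor (affineSimplex w s) (affineSimplex w s) := by
  rw [neg_lor_affineSimplex]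
  calc c = ∑ i, ∑ j, s i * s j * c := by
        simp only [mul_assoc, ← Finset.mul_sum, ← Finset.sum_mul, hs.2, one_mul]
    _ ≤ _ := Finset.sum_le_sum fun i _ => Finset.sum_le_sum fun j _ =>
        mul_le_mul_of_nonneg_left (h i j) (mul_nonneg (hs.1 i) (hs.1 j))

/-- If only the products of distinct vertices are bounded away from zero, then `-⟨x, x⟩` still
controls `∑ sᵢ (1 - sᵢ)`, and hence each single summand. -/
lemma mul_le_neg_lor_affineSimplex {w : Fin (k + 1) → Mink n} {c : ℝ} (hc : 0 ≤ c)
    (hdiag : ∀ i, 0 ≤ -lor (w i) (w i)) (h : ∀ i j, i ≠ j → c ≤ -lor (w i) (w j))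
    {s : Fin (k + 1) → ℝ} (hs : s ∈ stdSimplex ℝ (Fin (k + 1))) (m : Fin (k + 1)) :
    c * (s m * (1 - s m)) ≤ -lor (affineSimplex w s) (affineSimplex w s) := by
  rw [neg_lor_affineSimplex]
  have hle : ∀ i, s i ≤ 1 := fun i => by
    rw [← hs.2]
    exact Finset.single_le_sum (fun j _ => hs.1 j) (Finset.mem_univ i)
  calc c * (s m * (1 - s m)) ≤ ∑ i, c * (s i * (1 - s i)) :=
        Finset.single_le_sum (f := fun i => c * (s i * (1 - s i)))
          (fun i _ => mul_nonneg hc (mul_nonneg (hs.1 i) (by linarith [hle i])))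
          (Finset.mem_univ m)
    _ = ∑ i, ∑ j, s i * s j * (if i = j then 0 else c) := by
        refine Finset.sum_congr rfl fun i _ => ?_
        have : ∀ j, s i * s j * (if i = j then 0 else c) =
            c * s i * s j - if i = j then c * s i * s j else 0 := by
          intro j
          split_ifs <;> ring
        simp only [this, Finset.sum_sub_distrib, ← Finset.mul_sum, hs.2, Finset.sum_ite_eq,
          Finset.mem_univ, if_true]
        ring
    _ ≤ _ := by
        refine Finset.sum_le_sum fun i _ => Finset.sum_le_sum fun j _ =>
          mul_le_mul_of_nonneg_left ?_ (mul_nonneg (hs.1 i) (hs.1 j))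
        split_ifs with hij
        · subst hij; exact hdiag i
        · exact h i j hij

lemma continuous_affineSimplex_baryChart (w : Fin (k + 1) → Mink n) :
    Continuous fun x : Fin k → ℝ => affineSimplex w (baryChart x) := by
  simp only [affineSimplex_baryChart]
  fun_prop

lemma measurable_density (w : Fin (k + 1) → Mink n) : Measurable (density w) := by
  have h := continuous_affineSimplex_baryChart w
  have h2 := (continuous_lor.comp (h.prodMk h)).neg.measurable
  exact ((h2.pow_const (k + 1)).const_div _).sqrt

lemma openCoordSimplex_subset : openCoordSimplex k ⊆ Set.pi univ fun _ => Ioo (0 : ℝ) 1 :=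
  fun _ hx i _ => ⟨hx.1 i,
    (Finset.single_le_sum (fun j _ => (hx.1 j).le) (Finset.mem_univ i)).trans_lt hx.2⟩

lemma lintegral_density_ne_top_of_le {w : Fin (k + 1) → Mink n} {c : ℝ} (hc : 0 < c)
    (h : ∀ i j, c ≤ -lor (w i) (w j)) :
    ∫⁻ x in openCoordSimplex k, ENNReal.ofReal (density w x) ≠ ⊤ := by
  have hvol : volume (openCoordSimplex k) ≠ ⊤ := by
    refine ne_top_of_le_ne_top ?_ (measure_mono openCoordSimplex_subset)
    simp [volume_pi_pi]
  refine ne_top_of_le_ne_top (ENNReal.mul_ne_top (ENNReal.ofReal_ne_top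
    (r := √(|(edgeGram w (w 0)).det| / c ^ (k + 1)))) hvol) ?_
  rw [← setLIntegral_const]
  refine setLIntegral_mono measurable_const fun x hx => ENNReal.ofReal_le_ofReal ?_
  refine Real.sqrt_le_sqrt ?_
  have := le_neg_lor_affineSimplex h (baryChart_mem_stdSimplex hx)
  gcongr
  exact neg_le_abs _

/-! ### The dominating function -/

/-- The function `(c x (1 - x)) ^ (-(k + 1) / (2 k))` on the unit interval, extended by zero. -/
def betaFactor (k : ℕ) (c : ℝ) : ℝ → ℝ :=
  indicator (Ioo 0 1) fun x => (c * (x * (1 - x))) ^ (-((k + 1) / (2 * k)) : ℝ)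

/-- For `k ≥ 2` the exponent exceeds `-1`, so this is a convergent Beta integral. -/
lemma integrable_betaFactor (hk : 2 ≤ k) {c : ℝ} (hc : 0 < c) : Integrable (betaFactor k c) := by
  have hk' : (2 : ℝ) ≤ k := by exact_mod_cast hk
  set a : ℝ := (k + 1) / (2 * k) with ha
  have ha1 : a < 1 := by rw [ha, div_lt_one (by positivity)]; linarith
  rw [betaFactor, integrable_indicator_iff measurableSet_Ioo, ← ha]
  have h := Complex.betaIntegral_convergent (u := ((1 - a : ℝ) : ℂ)) (v := ((1 - a : ℝ) : ℂ))
    (by simpa using ha1) (by simpa using ha1)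
  rw [intervalIntegrable_iff_integrableOn_Ioo_of_le zero_le_one] at h
  refine IntegrableOn.congr_fun (h.norm.const_mul (c ^ (-a))) (fun x hx => ?_) measurableSet_Ioo
  have h1 : 0 < 1 - x := by linarith [hx.2]
  have e : (1 : ℂ) - (x : ℂ) = ((1 - x : ℝ) : ℂ) := by push_cast; ring
  simp only [norm_mul, e, Complex.norm_cpow_eq_rpow_re_of_pos hx.1,
    Complex.norm_cpow_eq_rpow_re_of_pos h1]
  rw [Real.mul_rpow hc.le (mul_nonneg hx.1.le h1.le), Real.mul_rpow hx.1.le h1.le]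
  simp

/-- The exponent `(k + 1) / 2` of `-⟨x, x⟩` in the density is distributed evenly over the `k`
coordinates, each of which controls `-⟨x, x⟩` from below. -/
lemma density_le_prod_betaFactor (hk : 1 ≤ k) {w : Fin (k + 1) → Mink n} {c M : ℝ} (hc : 0 < c)
    (hdiag : ∀ i, 0 ≤ -lor (w i) (w i)) (h : ∀ i j, i ≠ j → c ≤ -lor (w i) (w j))
    (hM : |(edgeGram w (w 0)).det| ≤ M) {x : Fin k → ℝ} (hx : x ∈ openCoordSimplex k) :
    density w x ≤ √M * ∏ i, betaFactor k c (x i) := by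
  have hk0 : (k : ℝ) ≠ 0 := by positivity
  have hM0 : 0 ≤ M := (abs_nonneg _).trans hM
  have hφ : ∀ i, c * (x i * (1 - x i)) ≤
      -lor (affineSimplex w (baryChart x)) (affineSimplex w (baryChart x)) := fun i =>
    mul_le_neg_lor_affineSimplex hc.le hdiag h (baryChart_mem_stdSimplex hx) i.succ
  rw [density]
  set φ := -lor (affineSimplex w (baryChart x)) (affineSimplex w (baryChart x))
  have hpos : ∀ i, 0 < c * (x i * (1 - x i)) := fun i => by
    have := openCoordSimplex_subset hx i (mem_univ i)
    exact mul_pos hc (mul_pos this.1 (by linarith [this.2]))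
  have hφ0 : 0 < φ := (hpos ⟨0, hk⟩).trans_le (hφ _)
  calc √(-(edgeGram w (w 0)).det / φ ^ (k + 1)) ≤ √(M / φ ^ (k + 1)) := by
        gcongr
        exact (neg_le_abs _).trans hM
    _ = √M * ∏ _i : Fin k, φ ^ (-((k + 1) / (2 * k)) : ℝ) := by
        rw [Real.sqrt_div hM0, div_eq_mul_inv, Finset.prod_const, Finset.card_univ,
          Fintype.card_fin, ← Real.rpow_mul_natCast hφ0.le, Real.sqrt_eq_rpow (φ ^ (k + 1)),
          ← Real.rpow_natCast φ (k + 1), ← Real.rpow_mul hφ0.le, ← Real.rpow_neg hφ0.le]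
        congr 2
        push_cast
        field_simp
    _ ≤ √M * ∏ i, betaFactor k c (x i) := by
        gcongr with i
        rw [betaFactor, indicator_of_mem (openCoordSimplex_subset hx i (mem_univ i))]
        exact Real.rpow_le_rpow_of_nonpos (hpos i) (hφ i) (neg_nonpos.2 (by positivity))

lemma lintegral_prod_betaFactor_ne_top (hk : 2 ≤ k) {c : ℝ} (hc : 0 < c) (M : ℝ) :
    ∫⁻ x in openCoordSimplex k, ENNReal.ofReal (√M * ∏ i, betaFactor k c (x i)) ≠ ⊤ := by
  have h : Integrable fun x : Fin k → ℝ => ∏ i, betaFactor k c (x i) :=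
    Integrable.fintype_prod fun _ => integrable_betaFactor hk hc
  exact (h.const_mul (√M)).integrableOn.lintegral_lt_top.ne

/-! ### Ideal segments have infinite length -/

lemma lintegral_inv_Ioo_eq_top : ∫⁻ x in Ioo (0 : ℝ) 1, ENNReal.ofReal (2 * x)⁻¹ = ⊤ := by
  by_contra hne
  have hm : Measurable fun x : ℝ => (2 * x)⁻¹ := by fun_prop
  have h : IntegrableOn (fun x : ℝ => (2 * x)⁻¹) (Ioo 0 1) := by
    refine (lintegral_ofReal_ne_top_iff_integrable hm.aestronglyMeasurable ?_).1 hne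
    refine ae_restrict_of_forall_mem measurableSet_Ioo fun x hx => ?_
    have := hx.1
    simp only [Pi.zero_apply]
    positivity
  have h2 : IntegrableOn (fun x : ℝ => x ^ (-1 : ℝ)) (Ioo 0 1) := by
    refine (Integrable.const_mul h 2).congr (Eventually.of_forall fun x => ?_)
    simp only [mul_inv, Real.rpow_neg_one]
    ring
  rw [intervalIntegral.integrableOn_Ioo_rpow_iff one_pos] at h2
  exact lt_irrefl _ h2

lemma lintegral_density_eq_top {w : Fin 2 → Mink n} (h0 : lor (w 0) (w 0) = 0)
    (h1 : lor (w 1) (w 1) = 0) (h01 : lor (w 0) (w 1) < 0) :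
    ∫⁻ x in openCoordSimplex 1, ENNReal.ofReal (density w x) = ⊤ := by
  have hle : ∀ x ∈ openCoordSimplex 1, (2 * x 0)⁻¹ ≤ density w x := by
    intro x hx
    obtain ⟨hx0, hx1⟩ := openCoordSimplex_subset hx 0 (mem_univ 0)
    have hdet := det_edgeGram_add w (w 0) x
    rw [← affineSimplex_baryChart] at hdet
    set g := -lor (w 0) (w 1) with hg
    have hg0 : 0 < g := by linarith
    have hX : -lor (affineSimplex w (baryChart x)) (affineSimplex w (baryChart x)) =
        2 * x 0 * (1 - x 0) * g := by
      rw [neg_lor_affineSimplex]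
      simp [Fin.sum_univ_two, baryChart, h0, h1, lor_comm (w 1) (w 0)]
      rw [hg]; ring
    have hXpos : 0 < 2 * x 0 * (1 - x 0) * g := by
      have : 0 < 1 - x 0 := by linarith
      positivity
    have hXe : lor (affineSimplex w (baryChart x)) (edge w 0) = g * (2 * x 0 - 1) := by
      rw [affineSimplex_baryChart]
      simp [edge, lor_sub_left, lor_sub_right, lor_add_left, lor_smul_left, h0, h1, lor_comm (w 1) (w 0)]
      rw [hg]; ring
    have hee : lor (edge w 0) (edge w 0) = 2 * g := by
      simp [edge, lor_sub_left, lor_sub_right, h0, h1, lor_comm (w 1) (w 0)]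
      rw [hg]; ring
    have hd : (edgeGram w (w 0)).det = -g ^ 2 := by
      rw [← hdet, det_edgeGram_eq_mul w (by linarith), Matrix.det_fin_one, Matrix.of_apply, hXe,
        hee, ← neg_neg (lor (affineSimplex w _) _), hX]
      have := hXpos.ne'
      field_simp
      ring
    rw [density, hd, hX, neg_neg, ← div_pow, Real.sqrt_sq (by positivity), inv_eq_one_div,
      div_le_div_iff₀ (by positivity) hXpos]
    nlinarith [mul_pos hx0 hg0, mul_pos hx0 (mul_pos hx0 hg0)]
  rw [eq_top_iff, ← lintegral_inv_Ioo_eq_top]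
  have hmp := volume_preserving_funUnique (Fin 1) ℝ
  rw [← hmp.setLIntegral_comp_preimage_emb (MeasurableEquiv.measurableEmbedding _)
    (fun x => ENNReal.ofReal (2 * x)⁻¹) (Ioo 0 1)]
  have hset : (MeasurableEquiv.funUnique (Fin 1) ℝ) ⁻¹' Ioo 0 1 = openCoordSimplex 1 := by
    ext x
    simp [openCoordSimplex, MeasurableEquiv.funUnique_apply]
  rw [hset]
  exact setLIntegral_mono ((measurable_density w).ennreal_ofReal) fun x hx =>
    ENNReal.ofReal_le_ofReal (hle x hx)

/-! ### Convergence of the volumes -/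

lemma continuous_det_edgeGram :
    Continuous fun w : Fin (k + 1) → Mink n => (edgeGram w (w 0)).det := by
  refine Continuous.matrix_det (continuous_matrix fun a b => ?_)
  have : ∀ a : Unit ⊕ Fin k, Continuous fun w : Fin (k + 1) → Mink n =>
      Sum.elim (fun _ => w 0) (edge w) a := by
    rintro (a | a)
    · exact continuous_apply 0
    · exact (continuous_apply _).sub (continuous_apply _)
  exact continuous_lor.comp ((this a).prodMk (this b))

lemma continuous_affineSimplex (s : Fin (k + 1) → ℝ) :
    Continuous fun w : Fin (k + 1) → Mink n => affineSimplex w s := by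
  unfold affineSimplex
  fun_prop

lemma continuousAt_density {w : Fin (k + 1) → Mink n} {x : Fin k → ℝ}
    (h : lor (affineSimplex w (baryChart x)) (affineSimplex w (baryChart x)) ≠ 0) :
    ContinuousAt (fun w => density w x) w := by
  have hc := continuous_affineSimplex (n := n) (baryChart x)
  have hl := (continuous_lor.comp (hc.prodMk hc)).neg.pow (k + 1)
  exact (continuous_det_edgeGram.neg.continuousAt.div hl.continuousAt
    (pow_ne_zero _ (neg_ne_zero.2 h))).sqrt

/-- The volumes of the simplices spanned by `w t` converge if the `w t i` are causal and converge to
light-like vectors which are pairwise not orthogonal. -/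
lemma tendsto_lintegral_density (hk : 1 ≤ k) {u : Fin (k + 1) → Mink n}
    (hu : ∀ i, lor (u i) (u i) = 0) (huv : ∀ i j, i ≠ j → lor (u i) (u j) < 0)
    {w : ℝ → Fin (k + 1) → Mink n} (hw : Tendsto w atTop (𝓝 u))
    (hdiag : ∀ᶠ t in atTop, ∀ i, lor (w t i) (w t i) ≤ 0) :
    (∀ x ∈ openCoordSimplex k,
      lor (affineSimplex u (baryChart x)) (affineSimplex u (baryChart x)) < 0) ∧
    (2 ≤ k → ∫⁻ x in openCoordSimplex k, ENNReal.ofReal (density u x) ≠ ⊤) ∧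
    Tendsto (fun t => ∫⁻ x in openCoordSimplex k, ENNReal.ofReal (density (w t) x)) atTop
      (𝓝 (∫⁻ x in openCoordSimplex k, ENNReal.ofReal (density u x))) := by
  obtain ⟨c, hc, hcu⟩ : ∃ c : ℝ, 0 < c ∧ ∀ i j, i ≠ j → c < -lor (u i) (u j) := by
    have h : ∀ᶠ c in 𝓝[>] (0 : ℝ), ∀ i j, i ≠ j → c < -lor (u i) (u j) := by
      simp only [eventually_all]
      intro i j hij
      exact nhdsWithin_le_nhds (gt_mem_nhds (by linarith [huv i j hij]))
    obtain ⟨c, h1, h2⟩ := (h.and self_mem_nhdsWithin).exists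
    exact ⟨c, h2, h1⟩
  have hneg : ∀ x ∈ openCoordSimplex k,
      lor (affineSimplex u (baryChart x)) (affineSimplex u (baryChart x)) < 0 := by
    intro x hx
    have h1 := mul_le_neg_lor_affineSimplex hc.le (fun i => by simp [hu i])
      (fun i j hij => (hcu i j hij).le) (baryChart_mem_stdSimplex hx) (Fin.succ ⟨0, hk⟩)
    simp only [baryChart, Fin.cons_succ] at h1
    have h2 := openCoordSimplex_subset hx ⟨0, hk⟩ (mem_univ _)
    have h3 := mul_pos hc (mul_pos h2.1 (sub_pos.2 h2.2))
    simp only [baryChart]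
    linarith
  have hlim : ∀ x ∈ openCoordSimplex k, Tendsto (fun t => ENNReal.ofReal (density (w t) x)) atTop
      (𝓝 (ENNReal.ofReal (density u x))) := fun x hx =>
    (ENNReal.continuous_ofReal.tendsto _).comp
      ((continuousAt_density (hneg x hx).ne).tendsto.comp hw)
  refine ⟨hneg, ?_⟩
  rcases hk.eq_or_lt with rfl | hk2
  · have htop := lintegral_density_eq_top (hu 0) (hu 1) (huv 0 1 (by simp))
    refine ⟨by simp, ?_⟩
    rw [htop]
    -- For `k = 1` there is no dominating function, but Fatou's lemma suffices.
    refine tendsto_of_le_liminf_of_limsup_le ?_ le_top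
    rw [← htop]
    refine le_trans (le_of_eq ?_) (lintegral_liminf_le fun t =>
      (measurable_density (w t)).ennreal_ofReal)
    exact setLIntegral_congr_fun measurableSet_openCoordSimplex fun x hx =>
      (hlim x hx).liminf_eq.symm
  · set M := |(edgeGram u (u 0)).det| + 1 with hM
    refine ⟨fun _ => ne_top_of_le_ne_top (lintegral_prod_betaFactor_ne_top hk2 hc M)
      (setLIntegral_mono' measurableSet_openCoordSimplex fun x hx => ENNReal.ofReal_le_ofReal
        (density_le_prod_betaFactor hk hc (fun i => by simp [hu i])
          (fun i j hij => (hcu i j hij).le) (by linarith) hx)), ?_⟩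
    have hoff : ∀ᶠ t in atTop, ∀ i j, i ≠ j → c < -lor (w t i) (w t j) := by
      simp only [eventually_all]
      intro i j hij
      have : Continuous fun w : Fin (k + 1) → Mink n => -lor (w i) (w j) :=
        by
        unfold lor; fun_prop
      exact ((this.tendsto u).comp hw).eventually (lt_mem_nhds (hcu i j hij))
    have hdet : ∀ᶠ t in atTop, |(edgeGram (w t) (w t 0)).det| < M :=
      (((continuous_det_edgeGram (n := n) (k := k)).abs.tendsto u).comp hw).eventually
        (gt_mem_nhds (by linarith))
    refine tendsto_lintegral_filter_of_dominated_convergence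
      (fun x => ENNReal.ofReal (√M * ∏ i, betaFactor k c (x i)))
      (Eventually.of_forall fun t => (measurable_density (w t)).ennreal_ofReal) ?_
      (lintegral_prod_betaFactor_ne_top hk2 hc M)
      (ae_restrict_of_forall_mem measurableSet_openCoordSimplex hlim)
    filter_upwards [hdiag, hoff, hdet] with t h1 h2 h3
    exact ae_restrict_of_forall_mem measurableSet_openCoordSimplex fun x hx =>
      ENNReal.ofReal_le_ofReal (density_le_prod_betaFactor hk hc (fun i => by linarith [h1 i])
        (fun i j hij => (h2 i j hij).le) h3.le hx)

end HypSimplex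

end

theorem lemma2 (n k : ℕ) (hk : 1 ≤ k) (hkn : k ≤ n)
    (p : Fin (k + 1) → HypSimplex.Euc n) (hp : ∀ i, p i ∈ HypSimplex.disc n)
    (ξ : Fin (k + 1) → HypSimplex.Euc n) (hξ : ∀ i, ξ i ∈ HypSimplex.sphereInfty n)
    (v : Fin (k + 1) → ℝ → HypSimplex.Euc n)
    (hray : ∀ i, ∀ t : ℝ, 0 ≤ t → v i t ∈ HypSimplex.geodesicRay (p i) (ξ i))
    (hspeed : ∀ i, ∀ t : ℝ, 0 ≤ t → HypSimplex.hypDist (v i 0) (v i t) = t)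
    (hdistinct : Function.Injective ξ) :
    ∃ τ : (Fin (k + 1) → ℝ) → HypSimplex.Euc n,
      HypSimplex.IsStraightIdealSimplex ξ τ ∧
      (∀ s ∈ stdSimplex ℝ (Fin (k + 1)),
        Tendsto (fun t : ℝ => HypSimplex.straightSimplex (fun i => v i t) s) atTop (𝓝 (τ s))) ∧
      (∀ t : ℝ, 0 ≤ t → HypSimplex.simplexVol (HypSimplex.straightSimplex (fun i => v i t)) ≠ ⊤) ∧
      (2 ≤ k → HypSimplex.simplexVol τ ≠ ⊤) ∧
      Tendsto (fun t : ℝ => HypSimplex.simplexVol (HypSimplex.straightSimplex (fun i => v i t)))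
        atTop (𝓝 (HypSimplex.simplexVol τ)) := by
  open HypSimplex in
  have hdisc : ∀ i t, 0 ≤ t → v i t ∈ disc n := fun i t ht =>
    (exists_lift_eq_of_mem_geodesicRay (hp i) (hξ i) (hray i t ht)).1
  choose m hm hlim using fun i =>
    exists_tendsto_inv_cosh_smul_lift (hp i) (hξ i) (hray i) (hspeed i)
  set u : Fin (k + 1) → Mink n := fun i => m i • ideal (ξ i) with hu_def
  -- The common factor `1 / cosh t` changes neither the straight simplex nor its volume.
  set w : ℝ → Fin (k + 1) → Mink n := fun t i => (Real.cosh t)⁻¹ • lift (v i t) with hw_def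
  have hw : Tendsto w atTop (𝓝 u) := tendsto_pi_nhds.2 hlim
  have hcosh : ∀ t, 0 < (Real.cosh t)⁻¹ := fun t => inv_pos.2 (Real.cosh_pos t)
  have hstraight : ∀ t, straightSimplex (fun i => v i t) = fun s => proj (affineSimplex (w t) s) :=
    fun t => funext fun s => by
      rw [hw_def, affineSimplex_smul, proj_smul (hcosh t).ne', straightSimplex]
  have hu2 : ∀ i, 0 < (u i).2 := fun i => by simpa [hu_def, ideal] using hm i
  have hu0 : ∀ i, lor (u i) (u i) = 0 := fun i => by
    simp only [hu_def, lor_smul_left, lor_smul_right, lor_ideal_self (hξ i), mul_zero]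
  have huv : ∀ i j, i ≠ j → lor (u i) (u j) < 0 := fun i j hij => by
    simp only [hu_def, lor_smul_left, lor_smul_right]
    exact mul_neg_of_pos_of_neg (hm j) (mul_neg_of_pos_of_neg (hm i)
      (lor_ideal_neg (hξ i) (hξ j) (hdistinct.ne hij)))
  have hwle : ∀ t, 0 ≤ t → ∀ i j, (Real.cosh t)⁻¹ ^ 2 ≤ -lor (w t i) (w t j) := fun t ht i j => by
    have := one_le_neg_lor (lift_mem (hdisc i t ht)) (lift_mem (hdisc j t ht))
    simp only [hw_def, lor_smul_left, lor_smul_right]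
    nlinarith [pow_pos (hcosh t) 2]
  have hvol : ∀ t, 0 ≤ t → simplexVol (straightSimplex (fun i => v i t)) =
      ∫⁻ x in openCoordSimplex k, ENNReal.ofReal (density (w t) x) := fun t ht => by
    rw [hstraight]
    refine simplexVol_proj_affineSimplex (fun i => ?_) fun x hx => ?_
    · exact mul_pos (hcosh t) (lift_mem (hdisc i t ht)).2
    · have := le_neg_lor_affineSimplex (hwle t ht) (baryChart_mem_stdSimplex hx)
      linarith [pow_pos (hcosh t) 2]
  obtain ⟨hneg, hfin, hconv⟩ := tendsto_lintegral_density hk hu0 huv hw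
    ((eventually_ge_atTop 0).mono fun t ht i => by
      linarith [hwle t ht i i, pow_pos (hcosh t) 2])
  have hvolu := simplexVol_proj_affineSimplex hu2 hneg
  refine ⟨fun s => proj (affineSimplex u s), ⟨hξ, u, fun i => ⟨⟨hu0 i, hu2 i⟩, ?_⟩, fun _ _ => rfl⟩,
    fun s hs => ?_, fun t ht => ?_, fun hk2 => ?_, ?_⟩
  · rw [hu_def, proj_smul (hm i).ne']
    simp [proj, ideal]
  · simp only [hstraight]
    have hW := ((continuous_affineSimplex s).tendsto u).comp hw
    exact (hW.snd_nhds.inv₀ (affineSimplex_snd_pos hu2 hs).ne').smul hW.fst_nhds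
  · rw [hvol t ht]
    exact lintegral_density_ne_top_of_le (pow_pos (hcosh t) 2) (hwle t ht)
  · rw [hvolu]
    exact hfin hk2
  · rw [hvolu]
    exact hconv.congr' ((eventually_ge_atTop 0).mono fun t ht => (hvol t ht).symm)
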